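/- Let $m$ and $d$ be natural numbers. Then there is a positive integer $C=C(m,d)$, depending only on $m$ and $d$, with the following property. Let $D$ be a division ring with center $k$, and let $K$ be a (commutative, not necessarily central) subfield of $D$ such that $D$ is left algebraic of bounded degree $d$ over $K$, i.e. for every $a\in D$ there are a natural number $n\le d$ and $\alpha_0,\ldots,\alpha_n\in K$ with $\alpha_n\neq 0$ and $$\sum_{j=0}^n \alpha_j a^j=0.$$ Then every $k$-subalgebra of $D$ that is generated (as a unital $k$-algebra) by $m$ elements satisfies the standard polynomial identity of degree $C$ $$s_C(y_1,\ldots,y_C)=\sum_{\pi\in S_C}\operatorname{sign}(\pi)\,y_{\pi(1)}\cdots y_{\pi(C)}=0.$$ -/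

import Mathlib

/-- The value `s_n(y₁, …, yₙ) = ∑_{π ∈ Sₙ} sign(π) y_{π(1)} ⋯ y_{π(n)}` of the standard polynomial
of degree `n` in a (not necessarily commutative) ring. -/
def standardPolynomial {R : Type*} [Ring R] (n : ℕ) (y : Fin n → R) : R :=
  ∑ π : Equiv.Perm (Fin n),
    ((Equiv.Perm.sign π : ℤˣ) : ℤ) • (List.ofFn fun i => y (π i)).prod

/-- `R` satisfies the standard polynomial identity of degree `n`. -/
def SatisfiesStandardIdentity (R : Type*) [Ring R] (n : ℕ) : Prop :=
  ∀ y : Fin n → R, standardPolynomial n y = 0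

/-- `A` is left algebraic of bounded degree `d` over the subring `B`: every `a : A` is a root of
a left polynomial `∑ αⱼ aʲ` over `B` of degree at most `d` with regular leading coefficient.
If `B` is a field, then `A` is automatically a free left `B`-module and regular means nonzero. -/
def IsLeftAlgebraicOfBoundedDegree {A : Type*} [Ring A] (B : Subring A) (d : ℕ) : Prop :=
  ∀ a : A, ∃ n ≤ d, ∃ α : ℕ → B, IsRegular (α n) ∧
    ∑ j ∈ Finset.range (n + 1), (α j : A) * a ^ j = 0

open Polynomial

/-! Every `a` is algebraic of degree at most `d` over the center: right multiplication by `a` is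
`K`-linear, conjugates of `a` give local annihilators, these merge into one relation `∑ cⱼ x aʲ = 0`
for all `x`, and a solution of minimal support has central coefficients
(`exists_aeval_center_eq_zero`). For `a` separable of maximal degree, Jacobson–Noether makes its
centralizer `E` a field, and `D` has left dimension at most `d` over `E`. Hence `D` acts on an
`E`-space whose endomorphism ring has dimension at most `d ^ 2`, and `C = d ^ 2 + 1` works. -/

/-! ### Algebraicity over the center -/

/-- Scale a vector of minimal support to have a coordinate `1`; its commutator with `s` lies in `V`
and loses that coordinate, so it vanishes. -/
theorem Submodule.exists_ne_zero_forall_mem_centralizer {D ι : Type*} [DivisionRing D] [Fintype ι]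
    (S : Set D) (V : Submodule D (ι → D)) (hV : V ≠ ⊥)
    (hS : ∀ v ∈ V, ∀ s ∈ S, (fun i => v i * s) ∈ V) :
    ∃ v ∈ V, v ≠ 0 ∧ ∀ i, ∀ s ∈ S, s * v i = v i * s := by
  classical
  obtain ⟨v, ⟨hvV, hv0⟩, hmin⟩ := WellFounded.has_min
    (measure fun v : ι → D => (Finset.univ.filter fun i => v i ≠ 0).card).wf
    {v | v ∈ V ∧ v ≠ 0} ((Submodule.ne_bot_iff V).1 hV)
  obtain ⟨j, hj⟩ := Function.ne_iff.1 hv0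
  simp only [Pi.zero_apply] at hj
  refine ⟨(v j)⁻¹ • v, V.smul_mem _ hvV, ?_, fun i s hs => ?_⟩
  · exact smul_ne_zero (inv_ne_zero hj) hv0
  set w := (v j)⁻¹ • v with hw
  have hwV : w ∈ V := V.smul_mem _ hvV
  have hwj : w j = 1 := by simp [hw, hj]
  by_contra hne
  refine hmin (s • w - fun i => w i * s) ⟨V.sub_mem (V.smul_mem _ hwV) (hS w hwV s hs), ?_⟩ ?_
  · intro h
    exact hne (sub_eq_zero.1 (by simpa using congrFun h i))
  · refine Finset.card_lt_card ?_
    refine ⟨fun l hl => ?_, fun hsub => ?_⟩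
    · simp only [Finset.mem_filter, Finset.mem_univ, true_and, ne_eq] at hl ⊢
      intro h
      exact hl (by simp [hw, h])
    · have := hsub (by simpa using hj : j ∈ Finset.univ.filter fun i => v i ≠ 0)
      simp [hwj] at this

/-- A finitely generated module over the PID `F[X]` has an element whose annihilator is that of the
whole module. -/
theorem LinearMap.exists_aeval_finset_eq_zero {F M : Type*} [Field F] [AddCommGroup M] [Module F M]
    (f : M →ₗ[F] M) (d : ℕ)
    (h : ∀ v, ∃ p : F[X], p ≠ 0 ∧ p.natDegree ≤ d ∧ aeval f p v = 0) (N : Finset M) :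
    ∃ p : F[X], p ≠ 0 ∧ p.natDegree ≤ d ∧ ∀ v ∈ N, aeval f p v = 0 := by
  classical
  let e := Module.AEval'.of f
  let P : Submodule F[X] (Module.AEval' f) := Submodule.span F[X] (N.image e : Finset _)
  have : Module.Finite F[X] P := Module.Finite.span_finset _ _
  obtain ⟨x, hx⟩ := Module.exists_ker_toSpanSingleton_eq_annihilator F[X] P
  have key : ∀ (p : F[X]) (v : M), p • e v = e (aeval f p v) := fun p v =>
    (Module.AEval.of_aeval_smul f p v).symm
  obtain ⟨p, hp0, hpd, hp⟩ := h (e.symm x)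
  refine ⟨p, hp0, hpd, fun v hv => ?_⟩
  have hpx : p ∈ LinearMap.ker (LinearMap.toSpanSingleton F[X] P x) := by
    rw [LinearMap.mem_ker, LinearMap.toSpanSingleton_apply]
    apply Subtype.ext
    have := key p (e.symm x)
    rw [hp, LinearEquiv.apply_symm_apply, map_zero] at this
    simpa using this
  rw [hx, Module.mem_annihilator] at hpx
  have hvP : e v ∈ P := Submodule.subset_span (by
    exact Finset.mem_coe.2 (Finset.mem_image_of_mem e hv))
  have := congrArg Subtype.val (hpx ⟨e v, hvP⟩)
  have h2 : p • e v = 0 := by simpa using this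
  rw [key] at h2
  simpa using h2

theorem LinearMap.exists_aeval_eq_zero_of_forall_exists {F M : Type*} [Field F] [AddCommGroup M]
    [Module F M] (f : M →ₗ[F] M) (d : ℕ)
    (h : ∀ v, ∃ p : F[X], p ≠ 0 ∧ p.natDegree ≤ d ∧ aeval f p v = 0) :
    ∃ p : F[X], p ≠ 0 ∧ p.natDegree ≤ d ∧ aeval f p = 0 := by
  classical
  let W : Finset M → Submodule F F[X] := fun N =>
    degreeLE F d ⊓ ⨅ v ∈ N, LinearMap.ker ((LinearMap.applyₗ v).comp (aeval f).toLinearMap)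
  have hW : ∀ N p, p ∈ W N ↔ p.natDegree ≤ d ∧ ∀ v ∈ N, aeval f p v = 0 := fun N p => by
    simp [W, mem_degreeLE, natDegree_le_iff_degree_le]
  have hfin : ∀ N, FiniteDimensional F (W N) := fun N => by
    have : FiniteDimensional F (degreeLE F d) := by
      rw [← Polynomial.degreeLT_succ_eq_degreeLE]
      exact Module.Finite.equiv (Polynomial.degreeLTEquiv F (d + 1)).symm
    exact Submodule.finiteDimensional_inf_left _ _
  -- Enlarging a finite set that minimizes `finrank` leaves `W N` unchanged, so a polynomial killing
  -- it kills every vector.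
  obtain ⟨N, -, hN⟩ := WellFounded.has_min
    (measure fun N : Finset M => Module.finrank F (W N)).wf Set.univ Set.univ_nonempty
  obtain ⟨p, hp0, hpd, hp⟩ := f.exists_aeval_finset_eq_zero d h N
  refine ⟨p, hp0, hpd, LinearMap.ext fun v => ?_⟩
  have hle : W (insert v N) ≤ W N := fun q hq => by
    rw [hW] at hq ⊢
    exact ⟨hq.1, fun u hu => hq.2 u (Finset.mem_insert_of_mem hu)⟩
  have heq : W (insert v N) = W N :=
    Submodule.eq_of_le_of_finrank_le hle (not_lt.1 (hN (insert v N) trivial))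
  have : p ∈ W (insert v N) := heq ▸ (hW N p).2 ⟨hpd, hp⟩
  exact ((hW _ p).1 this).2 v (Finset.mem_insert_self _ _)

/-- A division ring that is left algebraic of bounded degree over a commutative subfield is
algebraic of the same bounded degree over its center. -/
theorem exists_aeval_center_eq_zero {F D : Type*} [Field F] [DivisionRing D] (φ : F →+* D) (d : ℕ)
    (h : ∀ a : D, ∃ p : F[X], p ≠ 0 ∧ p.natDegree ≤ d ∧
      ∑ j ∈ Finset.range (d + 1), φ (p.coeff j) * a ^ j = 0) (a : D) :
    ∃ p : (Subring.center D)[X], p ≠ 0 ∧ p.natDegree ≤ d ∧ aeval a p = 0 := by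
  classical
  let : Module F D := Module.compHom D φ
  have smul_def : ∀ (c : F) (x : D), c • x = φ c * x := fun _ _ => rfl
  let f : D →ₗ[F] D :=
    { toFun := fun x => x * a
      map_add' := fun x y => add_mul x y a
      map_smul' := fun c x => by simp [smul_def, mul_assoc] }
  have fpow : ∀ (j : ℕ) (x : D), (f ^ j) x = x * a ^ j := fun j x => by
    induction j with
    | zero => simp
    | succ j ih => rw [pow_succ', Module.End.mul_apply, ih, pow_succ, ← mul_assoc]; rfl
  have haeval : ∀ (p : F[X]) (x : D), p.natDegree ≤ d →
      aeval f p x = ∑ j ∈ Finset.range (d + 1), φ (p.coeff j) * x * a ^ j := fun p x hp => by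
    rw [aeval_eq_sum_range' (Nat.lt_succ_of_le hp)]
    simp [LinearMap.sum_apply, fpow, smul_def, mul_assoc]
  obtain ⟨p, hp0, hpd, hp⟩ := f.exists_aeval_eq_zero_of_forall_exists d fun v => by
    rcases eq_or_ne v 0 with rfl | hv
    · exact ⟨1, one_ne_zero, by simp, by simp⟩
    -- Multiplied on the right by `v`, this becomes a relation among the `v * a ^ j`.
    obtain ⟨p, hp0, hpd, hp⟩ := h (v * a * v⁻¹)
    refine ⟨p, hp0, hpd, ?_⟩
    have hpow : ∀ j : ℕ, (v * a * v⁻¹) ^ j = v * a ^ j * v⁻¹ := fun j => by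
      induction j with
      | zero => simp [hv]
      | succ j ih => rw [pow_succ, ih, pow_succ]; simp [mul_assoc, hv]
    rw [haeval p v hpd]
    have := congrArg (· * v) hp
    simp only [hpow, Finset.sum_mul, zero_mul] at this
    simpa [mul_assoc, hv] using this
  let V : Submodule D (Fin (d + 1) → D) :=
    { carrier := {c | ∀ x : D, ∑ j, c j * x * a ^ (j : ℕ) = 0}
      add_mem' := fun {b c} hb hc x => by
        simp [add_mul, Finset.sum_add_distrib, hb x, hc x]
      zero_mem' := fun x => by simp
      smul_mem' := fun c b hb x => by
        simp only [Pi.smul_apply, smul_eq_mul, mul_assoc, ← Finset.mul_sum]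
        simpa [mul_assoc] using congrArg (c * ·) (hb x) }
  have hpV : (fun j : Fin (d + 1) => φ (p.coeff j)) ∈ V := fun x => by
    rw [Fin.sum_univ_eq_sum_range (fun j => φ (p.coeff j) * x * a ^ j), ← haeval p x hpd, hp]
    rfl
  have hV : V ≠ ⊥ := fun hbot => by
    rw [hbot, Submodule.mem_bot] at hpV
    refine hp0 (Polynomial.ext fun j => ?_)
    rcases lt_or_ge j (d + 1) with hj | hj
    · simpa using congrFun hpV ⟨j, hj⟩
    · simpa using coeff_eq_zero_of_natDegree_lt (hpd.trans_lt hj)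
  obtain ⟨c, hcV, hc0, hc⟩ := V.exists_ne_zero_forall_mem_centralizer Set.univ hV
    fun v hv s _ x => by simpa [mul_assoc] using hv (s * x)
  have hcc : ∀ i, c i ∈ Subring.center D := fun i =>
    Subring.mem_center_iff.2 fun s => hc i s trivial
  let q : (Subring.center D)[X] := ∑ j : Fin (d + 1), monomial (j : ℕ) ⟨c j, hcc j⟩
  have hq : ∀ j : Fin (d + 1), q.coeff j = ⟨c j, hcc j⟩ := fun j => by
    simp [q, coeff_monomial, Fin.val_inj]
  refine ⟨q, fun h0 => hc0 (funext fun j => ?_), ?_, ?_⟩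
  · have := hq j
    rw [h0, coeff_zero] at this
    exact (congrArg Subtype.val this).symm
  · exact natDegree_sum_le_of_forall_le _ _ fun j _ =>
      (natDegree_monomial_le _).trans (Nat.le_of_lt_succ j.2)
  · have := hcV 1
    simpa [q, map_sum, aeval_monomial, Algebra.algebraMap_eq_smul_one, Subring.smul_def] using this

/-! ### Standard identities -/

theorem standardPolynomial_map {R S : Type*} [Ring R] [Ring S] (f : R →+* S) (n : ℕ)
    (y : Fin n → R) : f (standardPolynomial n y) = standardPolynomial n fun i => f (y i) := by
  simp [standardPolynomial, map_sum, map_list_prod, List.map_ofFn, Function.comp_def]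

theorem SatisfiesStandardIdentity.of_injective {R S : Type*} [Ring R] [Ring S] {n : ℕ}
    (h : SatisfiesStandardIdentity S n) (f : R →+* S) (hf : Function.Injective f) :
    SatisfiesStandardIdentity R n := fun y =>
  hf (by rw [standardPolynomial_map, h, map_zero])

theorem SatisfiesStandardIdentity.mulOpposite {R : Type*} [Ring R] {n : ℕ}
    (h : SatisfiesStandardIdentity R n) : SatisfiesStandardIdentity Rᵐᵒᵖ n := fun y => by
  have key := h fun i => (y i).unop
  -- Reversing all products changes the sum only by the sign of `Fin.revPerm`.
  rw [standardPolynomial, ← Equiv.sum_comp (Equiv.mulRight (Fin.revPerm : Equiv.Perm (Fin n)))] at key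
  apply MulOpposite.unop_injective
  rw [standardPolynomial, Finset.unop_sum, MulOpposite.unop_zero]
  have h2 : ∀ π : Equiv.Perm (Fin n),
      (List.ofFn fun i => (y ((π * (Fin.revPerm : Equiv.Perm (Fin n))) i)).unop).prod
        = (List.ofFn fun i => y (π i)).prod.unop := fun π => by
    rw [MulOpposite.unop_list_prod, List.map_ofFn]
    congr 1
    refine List.ext_getElem (by simp) fun i h₁ h₂ => ?_
    simp only [List.length_ofFn] at h₁
    simp only [List.getElem_ofFn, List.getElem_reverse, List.length_ofFn, Function.comp_apply,
      Equiv.Perm.mul_apply, Fin.revPerm_apply]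
    congr 4
    ext
    simp [Fin.val_rev]
    omega
  simp only [Equiv.coe_mulRight, h2, map_mul] at key
  have h3 := congrArg (((Equiv.Perm.sign (Fin.revPerm : Equiv.Perm (Fin n)) : ℤˣ) : ℤ) • ·) key
  simp only [Finset.smul_sum, smul_smul, smul_zero, Units.val_mul] at h3
  simp only [MulOpposite.unop_smul]
  rw [← h3]
  refine Finset.sum_congr rfl fun π _ => ?_
  congr 1
  rcases Int.units_eq_one_or (Equiv.Perm.sign (Fin.revPerm : Equiv.Perm (Fin n))) with h | h <;>
    simp [h]

/-- The standard polynomial is the alternatization of the product, so it vanishes on linearly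
dependent families. -/
theorem SatisfiesStandardIdentity.of_finrank_lt {F E : Type*} [Field F] [Ring E] [Algebra F E]
    [FiniteDimensional F E] {n : ℕ} (hn : Module.finrank F E < n) :
    SatisfiesStandardIdentity E n := fun y => by
  have hdep : ¬ LinearIndependent F y := fun hli => by
    have := hli.fintype_card_le_finrank
    simp at this
    omega
  have := (MultilinearMap.alternatization (MultilinearMap.mkPiAlgebraFin F n E)).map_linearDependent
    y hdep
  rw [MultilinearMap.alternatization_apply] at this
  rw [standardPolynomial, ← this]
  refine Finset.sum_congr rfl fun π _ => ?_
  simp [Units.smul_def]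

/-- A ring that is a left vector space of dimension at most `d` over a commutative field embeds
through its right multiplications in a matrix ring of size `d`. -/
theorem SatisfiesStandardIdentity.of_forall_exists_sum_eq_zero {F D : Type*} [Field F]
    [Ring D] (φ : F →+* D) (d : ℕ)
    (h : ∀ v : Fin (d + 1) → D, ∃ c : Fin (d + 1) → F, c ≠ 0 ∧ ∑ i, φ (c i) * v i = 0) :
    SatisfiesStandardIdentity D (d ^ 2 + 1) := by
  let : Module F D := Module.compHom D φ
  have smul_def : ∀ (c : F) (x : D), c • x = φ c * x := fun _ _ => rfl
  have hrank : Module.rank F D ≤ d := by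
    refine rank_le fun s hs => ?_
    by_contra hcard
    obtain ⟨t, hts, ht⟩ := Finset.exists_subset_card_eq (not_le.1 hcard : d + 1 ≤ s.card)
    let e := (t.equivFinOfCardEq ht).symm
    have hli : LinearIndependent F fun i : Fin (d + 1) => ((e i : t) : D) := by
      have := hs.comp (fun i => (⟨e i, hts (e i).2⟩ : s)) fun i j hij => by
        simpa [Subtype.ext_iff] using hij
      exact this
    obtain ⟨c, hc0, hc⟩ := h fun i => (e i : t)
    exact hc0 (funext fun i => Fintype.linearIndependent_iff.1 hli c hc i)
  have : FiniteDimensional F D :=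
    Module.rank_lt_aleph0_iff.1 (hrank.trans_lt (Cardinal.natCast_lt_aleph0))
  have hfin : Module.finrank F D ≤ d := Module.finrank_le_of_rank_le hrank
  have hend : SatisfiesStandardIdentity (Module.End F D) (d ^ 2 + 1) := by
    refine .of_finrank_lt (F := F) ?_
    rw [Module.finrank_linearMap, ← sq]
    exact Nat.lt_succ_of_le (Nat.pow_le_pow_left hfin 2)
  let f : Dᵐᵒᵖ →+* Module.End F D :=
    { toFun := fun a =>
        { toFun := fun x => x * a.unop
          map_add' := fun x y => add_mul _ _ _
          map_smul' := fun c x => by simp [smul_def, mul_assoc] }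
      map_one' := by ext; simp
      map_mul' := fun a b => by ext x; simp [mul_assoc]
      map_zero' := by ext; simp
      map_add' := fun a b => by ext x; simp [mul_add] }
  have hop : SatisfiesStandardIdentity Dᵐᵒᵖ (d ^ 2 + 1) := hend.of_injective f fun a b hab =>
    MulOpposite.unop_injective (by simpa [f] using LinearMap.congr_fun hab 1)
  exact hop.mulOpposite.of_injective (RingEquiv.opOp D).toRingHom (RingEquiv.opOp D).injective

/-! ### Separable elements and centralizers -/

/-- The minimal polynomial divides `X ^ q ^ n - C z`, which has a single distinct root, so
separability forces degree 1. -/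
theorem IsSeparable.mem_range_of_pow_mem {Z E : Type*} [Field Z] [Ring E] [IsDomain E] [Algebra Z E]
    (q : ℕ) [ExpChar Z q] {x : E} (hx : IsSeparable Z x) (n : ℕ)
    (h : x ^ q ^ n ∈ (algebraMap Z E).range) : x ∈ (algebraMap Z E).range := by
  obtain ⟨z, hz⟩ := h
  have hdvd : minpoly Z x ∣ X ^ q ^ n - C z := minpoly.dvd _ _ (by simp [hz])
  have hne : (X ^ q ^ n - C z : Z[X]) ≠ 0 :=
    (monic_X_pow_sub_C z (pow_ne_zero _ (expChar_pos Z q).ne')).ne_zero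
  have hle := natSepDegree_le_of_dvd _ _ hdvd hne
  rw [natSepDegree_X_pow_char_pow_sub_C, natSepDegree_eq_natDegree_of_separable _ hx] at hle
  exact minpoly.natDegree_eq_one_iff.1 (hle.antisymm (minpoly.natDegree_pos hx.isIntegral))

theorem exists_isSeparable_pow {k E : Type*} [Field k] [Ring E] [IsDomain E] [Algebra k E]
    [Algebra.IsAlgebraic k E] (q : ℕ) [hq : ExpChar k q] (x : E) :
    ∃ n : ℕ, IsSeparable k (x ^ q ^ n) := by
  have hint := (Algebra.IsAlgebraic.isAlgebraic (R := k) x).isIntegral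
  obtain ⟨g, hg, n, hn⟩ := (minpoly.irreducible hint).hasSeparableContraction q
  refine ⟨n, hg.of_dvd (minpoly.dvd _ _ ?_)⟩
  have := minpoly.aeval k x
  rwa [← hn, expand_aeval] at this

/-- Jacobson–Noether gives a noncentral `x` separable over the center; some `x ^ q ^ n` is separable
over `k`, hence central, which forces `x` to be central. -/
theorem Subring.center_eq_top_of_forall_isSeparable {k E : Type*} [Field k] [DivisionRing E]
    [Algebra k E] [Algebra.IsAlgebraic k E] (h : ∀ x : E, IsSeparable k x → x ∈ Subring.center E) :
    Subring.center E = ⊤ := by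
  by_contra hne
  let ψ : k →+* Subring.center E := (algebraMap k E).codRestrict _ fun c =>
    Subring.mem_center_iff.2 fun x => (Algebra.commutes c x).symm
  let : Algebra k (Subring.center E) := ψ.toAlgebra
  have : IsScalarTower k (Subring.center E) E := .of_algebraMap_eq fun _ => rfl
  have : Algebra.IsAlgebraic (Subring.center E) E := .tower_top (K := k) _
  obtain ⟨x, hx, hsep⟩ := JacobsonNoether.exists_separable_and_not_isCentral E hne
  obtain ⟨q, hq⟩ := ExpChar.exists k
  have : ExpChar (Subring.center E) q := expChar_of_injective_ringHom ψ.injective q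
  obtain ⟨n, hn⟩ := exists_isSeparable_pow (k := k) q x
  obtain ⟨z, hz⟩ := hsep.mem_range_of_pow_mem q n ⟨⟨_, h _ hn⟩, rfl⟩
  exact hx (hz ▸ z.2)

/-- A primitive element of the separable extension `k(a, b)` has degree at most that of `a`, so
`k(a, b) = k(a)`. -/
theorem IsSeparable.mem_adjoin_of_commute {k D : Type*} [Field k] [DivisionRing D] [Algebra k D]
    {a b : D} (ha : IsSeparable k a) (hb : IsSeparable k b) (hab : Commute a b)
    (hmax : ∀ c : D, IsSeparable k c → (minpoly k c).natDegree ≤ (minpoly k a).natDegree) :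
    b ∈ Algebra.adjoin k {a} := by
  let E := Algebra.adjoin k {a, b}
  have : IsMulCommutative E := Algebra.isMulCommutative_adjoin k (by
    rintro x (rfl | rfl) y (rfl | rfl)
    exacts [rfl, hab, hab.symm, rfl])
  let : CommRing E := { (inferInstance : Ring E) with mul_comm := mul_comm' }
  let a' : E := ⟨a, Algebra.subset_adjoin (by simp)⟩
  let b' : E := ⟨b, Algebra.subset_adjoin (by simp)⟩
  have hval : Function.Injective E.val := Subtype.val_injective
  have hmin : ∀ x : E, minpoly k (x : D) = minpoly k x := fun x =>
    minpoly.algHom_eq E.val hval x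
  have htop : Algebra.adjoin k {a', b'} = ⊤ := by
    apply Subalgebra.map_injective hval
    rw [Algebra.map_top, Subalgebra.range_val, AlgHom.map_adjoin, Set.image_pair]
    rfl
  have ha' : IsSeparable k a' := by rw [IsSeparable, ← hmin]; exact ha
  have hb' : IsSeparable k b' := by rw [IsSeparable, ← hmin]; exact hb
  have hfin : Module.Finite k E := by
    rw [Module.finite_def, ← Algebra.top_toSubmodule, ← htop]
    exact fg_adjoin_of_finite (by simp) (by
      rintro x (rfl | rfl)
      exacts [ha'.isIntegral, hb'.isIntegral])
  have : IsDomain E := inferInstance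
  let : Field E := (isField_of_isIntegral_of_isField' (R := k) (Field.toIsField k)).toField
  have htop' : IntermediateField.adjoin k {a', b'} = ⊤ := by
    rw [← IntermediateField.toSubalgebra_inj, IntermediateField.top_toSubalgebra, eq_top_iff,
      ← htop]
    exact IntermediateField.algebra_adjoin_le_adjoin k _
  have hsepE : Algebra.IsSeparable k E := by
    rw [← separableClosure.eq_top_iff, eq_top_iff, ← htop', IntermediateField.adjoin_le_iff]
    rintro x (rfl | rfl)
    exacts [mem_separableClosure_iff.2 ha', mem_separableClosure_iff.2 hb']
  obtain ⟨c, hc⟩ := Field.exists_primitive_element k E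
  have hfr : Module.finrank k E = (minpoly k c).natDegree := by
    rw [← IntermediateField.finrank_top', ← hc, IntermediateField.adjoin.finrank (Algebra.IsSeparable.isIntegral k c)]
  have hle : (minpoly k c).natDegree ≤ (minpoly k a').natDegree := by
    rw [← hmin, ← hmin]
    exact hmax c (by rw [IsSeparable, hmin]; exact Algebra.IsSeparable.isSeparable k c)
  have hatop : IntermediateField.adjoin k {a'} = ⊤ := by
    apply IntermediateField.eq_of_le_of_finrank_le le_top
    rw [IntermediateField.finrank_top', hfr, IntermediateField.adjoin.finrank ha'.isIntegral]
    exact hle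
  have hb'' : b' ∈ Algebra.adjoin k {a'} := by
    rw [← IntermediateField.adjoin_simple_toSubalgebra_of_isAlgebraic, hatop]
    trivial
    exact ha'.isIntegral.isAlgebraic
  have : (b' : D) ∈ (Algebra.adjoin k {a'}).map E.val := ⟨b', hb'', rfl⟩
  rw [AlgHom.map_adjoin, Set.image_singleton] at this
  exact this

theorem exists_commute_sum_mul_eq_zero {k D : Type*} [Field k] [DivisionRing D] [Algebra k D]
    {a : D} (ha : IsIntegral k a) {d : ℕ} (hd : (minpoly k a).natDegree ≤ d)
    (v : Fin (d + 1) → D) :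
    ∃ c : Fin (d + 1) → D, c ≠ 0 ∧ (∀ i, Commute a (c i)) ∧ ∑ i, c i * v i = 0 := by
  let T : (Fin (d + 1) → D) →ₗ[D] Fin d → D :=
    { toFun := fun y i => ∑ j, y j * (a ^ (i : ℕ) * v j)
      map_add' := fun y z => by ext; simp [add_mul, Finset.sum_add_distrib]
      map_smul' := fun c y => by ext; simp [mul_assoc, Finset.mul_sum] }
  -- There are `d` equations in `d + 1` unknowns; reduction modulo `minpoly k a` extends them to all
  -- powers of `a`.
  have hker : LinearMap.ker T ≠ ⊥ := LinearMap.ker_ne_bot_of_finrank_lt (by simp)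
  have hT : ∀ y ∈ LinearMap.ker T, ∀ p : k[X], ∑ j, y j * (aeval a p * v j) = 0 := by
    intro y hy p
    have hdeg : (p %ₘ minpoly k a).natDegree < d :=
      (natDegree_modByMonic_lt p (minpoly.monic ha) (minpoly.ne_one k a)).trans_le hd
    rw [← minpoly.aeval_modByMonic_minpoly, aeval_eq_sum_range' hdeg]
    simp_rw [Finset.sum_mul, Finset.mul_sum]
    rw [Finset.sum_comm]
    refine Finset.sum_eq_zero fun i hi => ?_
    have := congrFun (LinearMap.mem_ker.1 hy) ⟨i, Finset.mem_range.1 hi⟩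
    simp_rw [smul_mul_assoc, mul_smul_comm, ← Finset.smul_sum]
    rw [show ∑ j, y j * (a ^ i * v j) = 0 from this, smul_zero]
  let V : Submodule D (Fin (d + 1) → D) :=
    { carrier := {y | ∀ i : ℕ, ∑ j, y j * (a ^ i * v j) = 0}
      add_mem' := fun {y z} hy hz i => by
        simp [add_mul, Finset.sum_add_distrib, hy i, hz i]
      zero_mem' := fun i => by simp
      smul_mem' := fun c y hy i => by
        simpa [mul_assoc, Finset.mul_sum] using congrArg (c * ·) (hy i) }
  have hV : V ≠ ⊥ := ne_bot_of_le_ne_bot hker fun y hy i => by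
    simpa using hT y hy (X ^ i)
  obtain ⟨c, hcV, hc0, hc⟩ := V.exists_ne_zero_forall_mem_centralizer {a} hV
    -- Right multiplication by `a` shifts the exponent `i` by one.
    fun y hy s hs i => by
      rw [Set.mem_singleton_iff.1 hs]
      simpa [mul_assoc, pow_succ'] using hy (i + 1)
  exact ⟨c, hc0, fun i => hc i a rfl, by simpa using hcV 0⟩

/-- A division algebra that is algebraic of degree at most `d` over a central subfield
satisfies the standard identity of degree `d ^ 2 + 1`. -/
theorem SatisfiesStandardIdentity.of_natDegree_minpoly_le {k D : Type*} [Field k] [DivisionRing D]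
    [Algebra k D] [Algebra.IsAlgebraic k D] (d : ℕ) (hd : ∀ a : D, (minpoly k a).natDegree ≤ d) :
    SatisfiesStandardIdentity D (d ^ 2 + 1) := by
  have hint : ∀ a : D, IsIntegral k a := fun a => (Algebra.IsAlgebraic.isAlgebraic a).isIntegral
  obtain ⟨a, ha, hmin⟩ := WellFounded.has_min
    (measure fun a : D => d - (minpoly k a).natDegree).wf {a | IsSeparable k a}
    ⟨_, isSeparable_algebraMap 0⟩
  have hmax : ∀ c : D, IsSeparable k c → (minpoly k c).natDegree ≤ (minpoly k a).natDegree := by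
    intro c hc
    have h1 : ¬ (d - (minpoly k c).natDegree < d - (minpoly k a).natDegree) := hmin c hc
    have := hd c
    have := hd a
    omega
  let E := Subalgebra.centralizer k {a}
  have hE : ∀ x : D, x ∈ E ↔ Commute a x := fun x => by
    simp [E, Subalgebra.mem_centralizer_iff, Commute, SemiconjBy]
  let : DivisionRing E := DivisionRing.ofIsUnitOrEqZero fun x => by
    refine or_iff_not_imp_right.2 fun hx => ?_
    have hx0 : (x : D) ≠ 0 := fun h => hx (Subtype.ext h)
    have hinv : (x : D)⁻¹ ∈ E := (hE _).2 (((hE _).1 x.2).inv_right₀)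
    exact ⟨⟨x, ⟨_, hinv⟩, Subtype.ext (mul_inv_cancel₀ hx0), Subtype.ext (inv_mul_cancel₀ hx0)⟩, rfl⟩
  have hval : Function.Injective E.val := Subtype.val_injective
  have hmp : ∀ x : E, minpoly k (x : D) = minpoly k x := fun x => minpoly.algHom_eq E.val hval x
  have : Algebra.IsAlgebraic k E := ⟨fun x =>
    ((isIntegral_algHom_iff E.val hval).1 (hint x)).isAlgebraic⟩
  -- By maximality, separable elements of `E` lie in `k[a]`, which commutes with all of `E`.
  have htop := Subring.center_eq_top_of_forall_isSeparable (k := k) (E := E) fun x hx => by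
    have hxD : IsSeparable k (x : D) := by rw [IsSeparable, hmp]; exact hx
    have hxa := ha.mem_adjoin_of_commute hxD ((hE _).1 x.2) hmax
    refine Subring.mem_center_iff.2 fun y => Subtype.ext ?_
    have hle : Algebra.adjoin k {a} ≤ Subalgebra.centralizer k {(y : D)} :=
      Algebra.adjoin_le (by
        simpa [Set.mem_centralizer_iff] using ((hE _).1 y.2).symm.eq)
    exact Subalgebra.mem_centralizer_iff k |>.1 (hle hxa) y rfl
  let : Field E := { (inferInstance : DivisionRing E) with
    mul_comm := fun x y =>
      (Subring.mem_center_iff.1 (htop ▸ Subring.mem_top y : y ∈ Subring.center E) x) }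
  refine .of_forall_exists_sum_eq_zero (F := E) E.val.toRingHom d fun v => ?_
  obtain ⟨c, hc0, hca, hc⟩ := exists_commute_sum_mul_eq_zero (hint a) (hd a) v
  exact ⟨fun i => ⟨c i, (hE _).2 (hca i)⟩,
    fun h => hc0 (funext fun i => congrArg Subtype.val (congrFun h i)), hc⟩

theorem lemma3p1 (m d : ℕ) :
    ∃ C : ℕ, 0 < C ∧
      ∀ (D : Type*) [DivisionRing D] (K : Subring D), IsField K →
        IsLeftAlgebraicOfBoundedDegree K d →
        ∀ A : Subalgebra (Subring.center D) D,
          (∃ x : Fin m → D, A = Algebra.adjoin (Subring.center D) (Set.range x)) →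
          SatisfiesStandardIdentity A C := by
  refine ⟨d ^ 2 + 1, Nat.succ_pos _, fun D _ K hK hKd A _ => ?_⟩
  let : Field K := hK.toField
  have halg := exists_aeval_center_eq_zero (F := K) K.subtype d fun a => by
    obtain ⟨n, hn, α, hα, hsum⟩ := hKd a
    refine ⟨∑ j ∈ Finset.range (n + 1), monomial j (α j), fun h => hα.ne_zero ?_, ?_, ?_⟩
    · simpa [coeff_monomial] using congrArg (coeff · n) h
    · exact natDegree_sum_le_of_forall_le _ _ fun j hj =>
        (natDegree_monomial_le _).trans ((Finset.mem_range_succ_iff.1 hj).trans hn)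
    · rw [← Finset.sum_subset (Finset.range_mono (Nat.succ_le_succ hn)), ← hsum]
      · refine Finset.sum_congr rfl fun j hj => ?_
        have : j < n + 1 := Finset.mem_range.1 hj
        simp [coeff_monomial, this]
      · intro j _ hj
        have : ¬ j < n + 1 := fun h => hj (Finset.mem_range.2 h)
        simp [coeff_monomial, this]
  have : Algebra.IsAlgebraic (Subring.center D) D := ⟨fun a =>
    let ⟨p, hp0, _, hp⟩ := halg a
    ⟨p, hp0, hp⟩⟩
  have hD : SatisfiesStandardIdentity D (d ^ 2 + 1) :=
    .of_natDegree_minpoly_le (k := Subring.center D) d fun a =>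
      let ⟨p, hp0, hpd, hp⟩ := halg a
      (natDegree_le_natDegree (minpoly.degree_le_of_ne_zero _ a hp0 hp)).trans hpd
  exact hD.of_injective A.val.toRingHom Subtype.val_injective
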